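/- Let $(R,\mathfrak m,k)$ be a commutative Noetherian local ring. A finitely generated $R$-module $G$ is totally reflexive if the evaluation map $G\to G^{**}$ is an isomorphism and $\mathrm{Ext}^i_R(G,R)=\mathrm{Ext}^i_R(G^*,R)=0$ for all $i>0$, where $(-)^*=\mathrm{Hom}_R(-,R)$. For a nonzero finitely generated $R$-module $M$, the Gorenstein dimension $\mathrm{G\text{-}dim}_R(M)$ is the minimal length of a resolution of $M$ by totally reflexive modules ($\infty$ if there is none of finite length). A proper resolution of $M$ is a resolution $\mathcal T\to M$ by totally reflexive modules such that the augmented sequence $\cdots\to\mathcal T_1\to\mathcal T_0\to M\to 0$ remains exact under $\mathrm{Hom}_R(G,-)$ for every totally reflexive $G$. For a module $M$ that admits a proper resolution $\mathcal T\to M$, and for a finitely generated module $N$, put $$\mathcal G\mathrm{Tor}_i^R(M,N)=H_i(\mathcal T\otimes_R N),\qquad s(M,N)=\sup\{i\ge 0\mid \mathcal G\mathrm{Tor}^R_i(M,N)\ne 0\},$$ and for any nonzero finitely generated $M,N$ put $$t(M,N)=\sup\{\operatorname{depth}R_{\mathfrak p}-\operatorname{depth}M_{\mathfrak p}-\operatorname{depth}N_{\mathfrak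 p}\mid \mathfrak p\in\operatorname{Supp}(M\otimes_R N)\}.$$ (1) Let $(R,\mathfrak m,k)$ be a Gorenstein local ring of Krull dimension one that is not regular. Then $\mathrm{G\text{-}dim}_R(k)=1$ and $t(k,k)=1$; the module $k$ admits a proper resolution, and, computed with any proper resolution of $k$, $\mathcal G\mathrm{Tor}^R_1(k,k)=0$ and $s(k,k)=0$. Thus $s(k,k)=0<1=t(k,k)$. (2) The strict inequality $s(M,N)<t(M,N)$ can occur for $M$ of finite Gorenstein dimension: there exist a commutative Noetherian local ring $R$ and nonzero finitely generated $R$-modules $M,N$ such that $\mathrm{G\text{-}dim}_R(M)<\infty$, $M$ admits a proper resolution, and, computed with any proper resolution of $M$, $s(M,N)<t(M,N)$. -/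

import Mathlib

open CategoryTheory MonoidalCategory

universe u

noncomputable section

namespace RelHom

section Ring

variable (R : Type u) [CommRing R]

/-- A Noetherian local ring is Gorenstein when it has finite injective dimension as a module
over itself. -/
class IsGorensteinLocalRing : Prop extends IsLocalRing R, IsNoetherianRing R where
  finite_injectiveDimension :
    ∃ n : ℕ, HasInjectiveDimensionLE (ModuleCat.of R R) n

/-- Totally reflexive modules: finitely generated modules `G` such that the evaluation map
`G → G**` is an isomorphism and `Ext^i(G, R) = Ext^i(G*, R) = 0` for all `i > 0`.
(The zero module is totally reflexive.) -/
structure IsTotallyReflexive (G : Type u) [AddCommGroup G] [Module R G] : Prop where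
  finite : Module.Finite R G
  eval_bijective : Function.Bijective (Module.Dual.eval R G)
  ext_eq_zero : ∀ i : ℕ, 0 < i →
    Subsingleton (Abelian.Ext.{u} (ModuleCat.of R G) (ModuleCat.of R R) i)
  ext_dual_eq_zero : ∀ i : ℕ, 0 < i →
    Subsingleton (Abelian.Ext.{u} (ModuleCat.of R (Module.Dual R G)) (ModuleCat.of R R) i)

variable (M : Type u) [AddCommGroup M] [Module R M]

/-- A resolution `⋯ → T₁ → T₀ → M → 0` of `M` by totally reflexive modules: the associated
augmented sequence is exact. -/
structure TRResolution where
  T : ChainComplex (ModuleCat.{u} R) ℕ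
  ε : T.X 0 →ₗ[R] M
  exact_succ : ∀ n : ℕ, Function.Exact (T.d (n + 2) (n + 1)).hom (T.d (n + 1) n).hom
  exact_zero : Function.Exact (T.d 1 0).hom ε
  surjective : Function.Surjective ε
  totallyReflexive : ∀ n : ℕ, IsTotallyReflexive R (T.X n)

/-- A proper resolution of `M`: a resolution by totally reflexive modules whose augmented sequence
`⋯ → T₁ → T₀ → M → 0` stays exact under `Hom_R(G, -)` for every totally reflexive `G`. -/
structure ProperResolution extends TRResolution R M where
  hom_exact_succ : ∀ (G : Type u) [AddCommGroup G] [Module R G], IsTotallyReflexive R G →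
    ∀ n : ℕ, Function.Exact
      (fun f : G →ₗ[R] T.X (n + 2) => (T.d (n + 2) (n + 1)).hom ∘ₗ f)
      (fun f : G →ₗ[R] T.X (n + 1) => (T.d (n + 1) n).hom ∘ₗ f)
  hom_exact_zero : ∀ (G : Type u) [AddCommGroup G] [Module R G], IsTotallyReflexive R G →
    Function.Exact
      (fun f : G →ₗ[R] T.X 1 => (T.d 1 0).hom ∘ₗ f)
      (fun f : G →ₗ[R] T.X 0 => ε ∘ₗ f)
  hom_surjective : ∀ (G : Type u) [AddCommGroup G] [Module R G], IsTotallyReflexive R G →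
    Function.Surjective (fun f : G →ₗ[R] T.X 0 => ε ∘ₗ f)

/-- The Gorenstein dimension of a (nonzero) module: the minimal length of a resolution by totally
reflexive modules, and `⊤` if there is no such resolution of finite length. -/
def GDim : ℕ∞ :=
  ⨅ (n : ℕ) (_ : ∃ P : TRResolution R M, ∀ i : ℕ, n < i → Subsingleton (P.T.X i)), (n : ℕ∞)

/-- The depth of a module over a local ring: the supremum of the lengths of the regular sequences
in the maximal ideal. For a nonzero finitely generated module over a Noetherian local ring a weakly
regular sequence in the maximal ideal is regular by Nakayama's lemma; the zero module has
depth `⊤`. -/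
def depth [IsLocalRing R] : ℕ∞ :=
  ⨆ (rs : List R) (_ : ∀ r ∈ rs, r ∈ IsLocalRing.maximalIdeal R)
    (_ : RingTheory.Sequence.IsWeaklyRegular M rs), (rs.length : ℕ∞)

/-- The depth of the localization `M_p` over `R_p`. -/
def depthAt (p : PrimeSpectrum R) : ℕ∞ :=
  depth (Localization.AtPrime p.asIdeal) (LocalizedModule p.asIdeal.primeCompl M)

/-- `t(M, N)`, the supremum of `depth R_p - depth M_p - depth N_p` for `p` in the support of
`M ⊗ N`. (For finitely generated `M`, `N` over a Noetherian ring these depths are finite.) -/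
def t (N : Type u) [AddCommGroup N] [Module R N] : EReal :=
  ⨆ p ∈ Module.support R (TensorProduct R M N),
    ((depthAt R R p : EReal) - (depthAt R M p : EReal) - (depthAt R N p : EReal))

end Ring

section Relative

variable {R : Type u} [CommRing R] {M : Type u} [AddCommGroup M] [Module R M]

/-- The relative homology `GTor_i(M, N) = H_i(T ⊗ N)`, computed from a proper resolution `T`
of `M`. -/
def GTor (P : ProperResolution R M) (N : Type u) [AddCommGroup N] [Module R N] (i : ℕ) :
    ModuleCat.{u} R :=
  (((tensorRight (ModuleCat.of R N)).mapHomologicalComplex (ComplexShape.down ℕ)).obj P.T).homology i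

/-- `s(M, N) = sup {i ≥ 0 | GTor_i(M, N) ≠ 0}`, computed from a proper resolution of `M`
(the supremum of the empty set is `⊥ = -∞`). -/
def s (P : ProperResolution R M) (N : Type u) [AddCommGroup N] [Module R N] : EReal :=
  ⨆ (i : ℕ) (_ : Nontrivial (GTor P N i)), (i : EReal)

end Relative

end RelHom

end

/-! Finite injective dimension in dimension one yields a nonzerodivisor `x` in `m` and vanishing of
`Ext^j(-, R)` on finitely generated modules for `j ≥ 2`, so finitely generated submodules of free
modules are totally reflexive. Choose `y` whose class in `R/(x)` is a nonzero socle element and put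
`E = (x, y)`. Then `0 → R → E → k → 0`, with `1 ↦ x`, is a resolution by totally reflexive modules,
and it is proper because maps `G → k` lift to `E` when `Ext^1(G, R) = 0`. After tensoring with `k`,
the map `k → E/mE` sends `1` to the class of `x`. If that class were zero, `m` would be principal
and `R` regular. Hence `GTor_1(k, k) = 0` while `GTor_0(k, k) ≠ 0`, and `s = 0`. Proper resolutions
are homotopy equivalent, so the choice does not matter. On the other side, `t = 1 - 0 - 0`, the
support of `k ⊗ k` being the closed point. For existence, the dual numbers over a discrete valuation
ring are Gorenstein, one-dimensional and not regular. -/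

noncomputable section

namespace RelHom

/-! ### Vanishing of `Ext(-, R)` along short exact sequences. -/

section ExtRing

variable {R : Type u} [CommRing R]

/-- The modules `Ext^i(M, R)`. -/
abbrev ExtRing (M : Type u) [AddCommGroup M] [Module R M] (i : ℕ) : Type u :=
  Abelian.Ext.{u} (ModuleCat.of R M) (ModuleCat.of R R) i

variable {A B C : Type u} [AddCommGroup A] [Module R A] [AddCommGroup B] [Module R B]
  [AddCommGroup C] [Module R C]

theorem shortExact_of_exact {f : A →ₗ[R] B} {g : B →ₗ[R] C} (hf : Function.Injective f)
    (hg : Function.Surjective g) (hfg : Function.Exact f g) :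
    (ModuleCat.shortComplexOfCompEqZero f g hfg.linearMap_comp_eq_zero).ShortExact :=
  ModuleCat.shortComplex_shortExact _ hfg hf hg

theorem subsingleton_extRing_middle {f : A →ₗ[R] B} {g : B →ₗ[R] C} (hf : Function.Injective f)
    (hg : Function.Surjective g) (hfg : Function.Exact f g) (i : ℕ)
    (hA : Subsingleton (ExtRing (R := R) A i)) (hC : Subsingleton (ExtRing (R := R) C i)) :
    Subsingleton (ExtRing (R := R) B i) := by
  refine subsingleton_of_forall_eq 0 fun z => ?_
  obtain ⟨w, rfl⟩ := Abelian.Ext.contravariant_sequence_exact₂ (shortExact_of_exact hf hg hfg) _ z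
    (hA.elim _ _)
  rw [hC.elim w 0, Abelian.Ext.comp_zero]

theorem subsingleton_extRing_left {f : A →ₗ[R] B} {g : B →ₗ[R] C} (hf : Function.Injective f)
    (hg : Function.Surjective g) (hfg : Function.Exact f g) (i : ℕ)
    (hB : Subsingleton (ExtRing (R := R) B i)) (hC : Subsingleton (ExtRing (R := R) C (i + 1))) :
    Subsingleton (ExtRing (R := R) A i) := by
  refine subsingleton_of_forall_eq 0 fun z => ?_
  obtain ⟨w, rfl⟩ := Abelian.Ext.contravariant_sequence_exact₁ (shortExact_of_exact hf hg hfg) _ z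
    (add_comm 1 i) (hC.elim _ _)
  rw [hB.elim w 0, Abelian.Ext.comp_zero]

theorem subsingleton_extRing_right {f : A →ₗ[R] B} {g : B →ₗ[R] C} (hf : Function.Injective f)
    (hg : Function.Surjective g) (hfg : Function.Exact f g) (i : ℕ)
    (hA : Subsingleton (ExtRing (R := R) A i)) (hB : Subsingleton (ExtRing (R := R) B (i + 1))) :
    Subsingleton (ExtRing (R := R) C (i + 1)) := by
  refine subsingleton_of_forall_eq 0 fun z => ?_
  obtain ⟨w, rfl⟩ := Abelian.Ext.contravariant_sequence_exact₃ (shortExact_of_exact hf hg hfg) _ z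
    (hB.elim _ _) (add_comm 1 i)
  rw [hA.elim w 0, Abelian.Ext.comp_zero]

theorem subsingleton_extRing_of_linearEquiv (e : A ≃ₗ[R] B) (i : ℕ)
    (hB : Subsingleton (ExtRing (R := R) B i)) : Subsingleton (ExtRing (R := R) A i) := by
  refine subsingleton_of_forall_eq 0 fun z => ?_
  have : z = (Abelian.Ext.mk₀ (e.toModuleIso.hom ≫ e.toModuleIso.inv)).comp z (zero_add i) := by
    rw [Iso.hom_inv_id, Abelian.Ext.mk₀_id_comp]
  rw [this, ← Abelian.Ext.mk₀_comp_mk₀,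
    Abelian.Ext.comp_assoc _ _ _ (zero_add 0) (zero_add i) (by omega),
    hB.elim ((Abelian.Ext.mk₀ e.toModuleIso.inv).comp z (zero_add i)) 0, Abelian.Ext.comp_zero]

theorem subsingleton_extRing_of_subsingleton [Subsingleton A] (i : ℕ) :
    Subsingleton (ExtRing (R := R) A i) := by
  refine subsingleton_of_forall_eq 0 fun z => ?_
  rw [← Abelian.Ext.mk₀_id_comp z,
    (ModuleCat.isZero_of_subsingleton (ModuleCat.of R A)).eq_of_src (𝟙 _) 0,
    Abelian.Ext.mk₀_zero, Abelian.Ext.zero_comp]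

theorem subsingleton_extRing_of_projective [Module.Projective R A] (i : ℕ) (hi : 0 < i) :
    Subsingleton (ExtRing (R := R) A i) := by
  obtain ⟨j, rfl⟩ := Nat.exists_eq_add_one.mpr hi
  exact subsingleton_of_forall_eq 0 fun z => Abelian.Ext.eq_zero_of_projective z

theorem linearMap_eq_zero_of_subsingleton_extRing_zero (h : Subsingleton (ExtRing (R := R) A 0))
    (f : A →ₗ[R] R) : f = 0 := by
  have := Abelian.Ext.homEquiv₀.symm.injective
    (h.elim (Abelian.Ext.homEquiv₀.symm (ModuleCat.ofHom f)) (Abelian.Ext.homEquiv₀.symm 0))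
  exact congrArg ModuleCat.Hom.hom this

/-- A linear form extends along an injection whose cokernel has vanishing `Ext^1`. -/
theorem exists_extend_of_subsingleton_extRing_one {f : A →ₗ[R] B} {g : B →ₗ[R] C}
    (hf : Function.Injective f) (hg : Function.Surjective g) (hfg : Function.Exact f g)
    (hC : Subsingleton (ExtRing (R := R) C 1)) (φ : A →ₗ[R] R) :
    ∃ ψ : B →ₗ[R] R, ψ ∘ₗ f = φ := by
  obtain ⟨w, hw⟩ := Abelian.Ext.contravariant_sequence_exact₁ (shortExact_of_exact hf hg hfg) _
    (Abelian.Ext.mk₀ (ModuleCat.ofHom φ)) (add_zero 1) (hC.elim _ _)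
  obtain ⟨ψ, rfl⟩ := Abelian.Ext.homEquiv₀.symm.surjective w
  rw [Abelian.Ext.homEquiv₀_symm_apply, Abelian.Ext.mk₀_comp_mk₀] at hw
  exact ⟨ψ.hom, congrArg ModuleCat.Hom.hom (Abelian.Ext.homEquiv₀.symm.injective hw)⟩

/-- A map to a quotient with kernel `R` lifts when the source has vanishing `Ext^1`. -/
theorem exists_lift_of_subsingleton_extRing_one {f : R →ₗ[R] B} {g : B →ₗ[R] C}
    (hf : Function.Injective f) (hg : Function.Surjective g) (hfg : Function.Exact f g)
    (hA : Subsingleton (ExtRing (R := R) A 1)) (φ : A →ₗ[R] C) :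
    ∃ ψ : A →ₗ[R] B, g ∘ₗ ψ = φ := by
  obtain ⟨w, hw⟩ := Abelian.Ext.covariant_sequence_exact₃ (ModuleCat.of R A)
    (shortExact_of_exact hf hg hfg) (Abelian.Ext.mk₀ (ModuleCat.ofHom φ)) (zero_add 1)
    (hA.elim _ _)
  obtain ⟨ψ, rfl⟩ := Abelian.Ext.homEquiv₀.symm.surjective w
  rw [Abelian.Ext.homEquiv₀_symm_apply, Abelian.Ext.mk₀_comp_mk₀] at hw
  exact ⟨ψ.hom, congrArg ModuleCat.Hom.hom (Abelian.Ext.homEquiv₀.symm.injective hw)⟩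

/-- Nakayama's lemma for `Ext`. -/
theorem subsingleton_extRing_of_isSMulRegular [IsLocalRing R] [IsNoetherianRing R]
    [Module.Finite R A] {x : R} (hx : x ∈ IsLocalRing.maximalIdeal R) (hreg : IsSMulRegular A x)
    (i : ℕ) (h : Subsingleton (ExtRing (R := R) (QuotSMulTop x A) (i + 1))) :
    Subsingleton (ExtRing (R := R) A i) := by
  have hfin : Module.Finite R (ExtRing (R := R) A i) := ModuleCat.finite_ext R _ _ i
  -- By the sequence `0 → A → A → A/xA → 0`, multiplication by `x` is surjective on the finitely
  -- generated module `Ext^i(A, R)`.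
  have key : (⊤ : Submodule R (ExtRing (R := R) A i)) ≤ IsLocalRing.maximalIdeal R • ⊤ := by
    intro z _
    obtain ⟨w, hw⟩ := Abelian.Ext.contravariant_sequence_exact₁
      (hreg.smulShortComplex_shortExact (M := ModuleCat.of R A)) (ModuleCat.of R R) z
      (add_comm 1 i) (h.elim _ _)
    replace hw : (Abelian.Ext.mk₀ (x • 𝟙 (ModuleCat.of R A))).comp (show ExtRing (R := R) A i from w)
      (zero_add i) = z := hw
    rw [Abelian.Ext.mk₀_smul, Abelian.Ext.smul_comp, Abelian.Ext.mk₀_id_comp] at hw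
    rw [← hw]
    exact Submodule.smul_mem_smul hx trivial
  have := Submodule.eq_bot_of_le_smul_of_le_jacobson_bot _ _ hfin.1 key
    (IsLocalRing.maximalIdeal_le_jacobson ⊥)
  exact (Submodule.subsingleton_iff R).mp (subsingleton_of_bot_eq_top this.symm)

end ExtRing

/-! ### Injective dimension of one-dimensional Gorenstein local rings. -/

section Gorenstein

open IsLocalRing

variable {R : Type u} [CommRing R] [IsLocalRing R] [IsNoetherianRing R]

/-- In a prime filtration of such an `N` only `R/m` occurs, since annihilators grow on passing to
submodules and quotients. -/
theorem subsingleton_extRing_of_annihilator {j : ℕ}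
    (hk : Subsingleton (ExtRing (R := R) (ResidueField R) j))
    (N : Type u) [AddCommGroup N] [Module R N] (hfin : Module.Finite R N)
    (hN : ∀ p : Ideal R, p.IsPrime → Module.annihilator R N ≤ p → p = maximalIdeal R) :
    Subsingleton (ExtRing (R := R) N j) := by
  induction hfin using IsNoetherianRing.induction_on_isQuotientEquivQuotientPrime R with
  | subsingleton N => exact subsingleton_extRing_of_subsingleton j
  | quotient N p e =>
    have hp : p.1 = maximalIdeal R :=
      hN p.1 p.2 (by rw [e.annihilator_eq, Ideal.annihilator_quotient])
    exact subsingleton_extRing_of_linearEquiv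
      (e.trans (Submodule.quotEquivOfEq _ _ hp) : N ≃ₗ[R] R ⧸ maximalIdeal R) j hk
  | exact N₁ N₂ N₃ f g hf hg hfg h₁ h₃ =>
    exact subsingleton_extRing_middle hf hg hfg j
      (h₁ fun p hp h => hN p hp ((f.annihilator_le_of_injective hf).trans h))
      (h₃ fun p hp h => hN p hp ((g.annihilator_le_of_surjective hg).trans h))

/-- In dimension at most one, vanishing of `Ext(-, R)` in high degrees is detected by the residue
field. -/
theorem subsingleton_extRing_of_residueField [Ring.KrullDimLE 1 R] {r : ℕ}
    (hk : ∀ j, r ≤ j → Subsingleton (ExtRing (R := R) (ResidueField R) j))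
    (N : Type u) [AddCommGroup N] [Module R N] (hfin : Module.Finite R N) (j : ℕ) (hj : r ≤ j) :
    Subsingleton (ExtRing (R := R) N j) := by
  induction hfin using IsNoetherianRing.induction_on_isQuotientEquivQuotientPrime R with
  | subsingleton N => exact subsingleton_extRing_of_subsingleton j
  | quotient N p e =>
    by_cases hp : p.1 = maximalIdeal R
    · exact subsingleton_extRing_of_linearEquiv
        (e.trans (Submodule.quotEquivOfEq _ _ hp) : N ≃ₗ[R] R ⧸ maximalIdeal R) j (hk j hj)
    · have := p.2
      -- Such an `x` is regular on `R/p`, and in dimension at most one only `m` contains both `p`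
      -- and `x`; Nakayama then reduces to degree `j + 1` for a module supported at `m`.
      obtain ⟨x, hxm, hxp⟩ := SetLike.exists_of_lt
        (lt_of_le_of_ne (le_maximalIdeal p.2.ne_top) hp)
      have hreg : IsSMulRegular N x := by
        rw [e.isSMulRegular_congr]
        rw [isSMulRegular_iff_right_eq_zero_of_smul]
        intro y hy
        obtain ⟨y, rfl⟩ := Ideal.Quotient.mk_surjective y
        rw [Algebra.smul_def, Ideal.Quotient.algebraMap_eq, ← map_mul,
          Ideal.Quotient.eq_zero_iff_mem] at hy
        exact Ideal.Quotient.eq_zero_iff_mem.mpr ((p.2.mem_or_mem hy).resolve_left hxp)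
      refine subsingleton_extRing_of_isSMulRegular hxm hreg j
        (subsingleton_extRing_of_annihilator (hk _ (by omega)) _ inferInstance fun q hq hle => ?_)
      have hxq : x ∈ q := hle (Module.mem_annihilator.mpr fun n => by
        obtain ⟨n, rfl⟩ := Submodule.mkQ_surjective _ n
        rw [← map_smul, Submodule.mkQ_apply, Submodule.Quotient.mk_eq_zero]
        exact Submodule.smul_mem_pointwise_smul _ _ _ trivial)
      have hpq : p.1 ≤ q := by
        refine le_trans ?_ hle
        conv_lhs => rw [← Ideal.annihilator_quotient (I := p.1), ← e.annihilator_eq]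
        exact LinearMap.annihilator_le_of_surjective _ (Submodule.mkQ_surjective _)
      rcases Ring.krullDimLE_one_iff.mp ‹_› q hq with h | h
      · exact absurd (h.2 ⟨p.2, bot_le⟩ hpq hxq) hxp
      · exact eq_maximalIdeal h
  | exact N₁ N₂ N₃ f g hf hg hfg h₁ h₃ => exact subsingleton_extRing_middle hf hg hfg j h₁ h₃

/-- If the residue field embeds in `M` with `Ext^j(M, R) = 0` for `j ≥ r`, then vanishing of
`Ext(-, R)` in all high degrees improves to vanishing in degrees `≥ r`. -/
theorem subsingleton_extRing_of_injective_residueField [Ring.KrullDimLE 1 R] {n r : ℕ}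
    (hn : ∀ (N : Type u) [AddCommGroup N] [Module R N], Module.Finite R N → ∀ j, n ≤ j →
      Subsingleton (ExtRing (R := R) N j))
    {M : Type u} [AddCommGroup M] [Module R M] [Module.Finite R M]
    (f : (R ⧸ maximalIdeal R) →ₗ[R] M) (hf : Function.Injective f)
    (hM : ∀ j, r ≤ j → Subsingleton (ExtRing (R := R) M j))
    (N : Type u) [AddCommGroup N] [Module R N] (hfin : Module.Finite R N) (j : ℕ) (hj : r ≤ j) :
    Subsingleton (ExtRing (R := R) N j) := by
  induction n with
  | zero => exact hn N hfin j (Nat.zero_le _)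
  | succ n ih =>
    by_cases hrn : r ≤ n
    · refine ih fun N _ _ hN j hj => subsingleton_extRing_of_residueField (r := n) ?_ N hN j hj
      intro j hj
      -- `Ext^j(k, R)` sits between `Ext^j(M, R)` and `Ext^{j+1}(M/k, R)`, so the bound drops from
      -- `n + 1` to `n`.
      exact subsingleton_extRing_left hf (Submodule.mkQ_surjective _)
        (LinearMap.exact_map_mkQ_range f) j (hM j (hrn.trans hj))
        (hn _ inferInstance _ (by omega))
    · exact hn N hfin j (by omega)

/-- Prime avoidance: if `m` consists of zero divisors, it lies in one of the finitely many
associated primes, hence equals it. -/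
theorem exists_mem_maximalIdeal_nonZeroDivisors_or_exists_injective :
    (∃ x ∈ maximalIdeal R, x ∈ nonZeroDivisors R) ∨
      ∃ f : (R ⧸ maximalIdeal R) →ₗ[R] R, Function.Injective f := by
  by_cases h : ∃ x ∈ maximalIdeal R, x ∈ nonZeroDivisors R
  · exact Or.inl h
  · push Not at h
    have fin := associatedPrimes.finite R R
    obtain ⟨P, hP, hle⟩ := ((maximalIdeal R).subset_union_prime_finite fin (f := id) 0 0
      fun _ h _ _ => h.isPrime).1 <| by
        simp_rw [id, biUnion_associatedPrimes_eq_compl_nonZeroDivisors]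
        exact fun x hx => h x hx
    obtain rfl : maximalIdeal R = P :=
      (maximalIdeal.isMaximal R).eq_of_le (IsAssociatedPrime.isPrime hP).ne_top hle
    exact Or.inr ((isAssociatedPrime_iff_exists_injective_linearMap _ _).mp hP).2

theorem exists_mem_maximalIdeal_nonZeroDivisors (hdim : ringKrullDim R = 1) {n : ℕ}
    (hn : ∀ (N : Type u) [AddCommGroup N] [Module R N], Module.Finite R N → ∀ j, n ≤ j →
      Subsingleton (ExtRing (R := R) N j)) :
    ∃ x ∈ maximalIdeal R, x ∈ nonZeroDivisors R := by
  have hdim1 : Ring.KrullDimLE 1 R := (Order.krullDimLE_iff 1 _).mpr hdim.le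
  refine exists_mem_maximalIdeal_nonZeroDivisors_or_exists_injective.resolve_right ?_
  rintro ⟨f, hf⟩
  -- If `k` embeds in `R`, then `Ext^j(-, R)` already vanishes for `j ≥ 1`. A nonmaximal minimal
  -- prime `p` will then give `Hom(R/p, R) = 0` by Nakayama, although `p` is associated to `R`.
  have key := subsingleton_extRing_of_injective_residueField (r := 1) hn f hf
    fun j hj => subsingleton_extRing_of_projective j hj
  have hdim0 : ¬ Ring.KrullDimLE 0 R := fun h => by
    have := (Order.krullDimLE_iff 0 _).mp h
    rw [← ringKrullDim, hdim] at this
    exact absurd this (by norm_num)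
  rw [Ring.krullDimLE_zero_iff_forall_minimalPrimes_isMaximal] at hdim0
  push Not at hdim0
  obtain ⟨p, hp, hpm⟩ := hdim0
  have hpp : p.IsPrime := hp.1.1
  obtain ⟨x, hxm, hxp⟩ := SetLike.exists_of_lt (lt_of_le_of_ne (le_maximalIdeal hpp.ne_top)
    fun h => hpm (h ▸ maximalIdeal.isMaximal R))
  have hreg : IsSMulRegular (R ⧸ p) x := by
    rw [isSMulRegular_iff_right_eq_zero_of_smul]
    intro y hy
    obtain ⟨y, rfl⟩ := Ideal.Quotient.mk_surjective y
    rw [Algebra.smul_def, Ideal.Quotient.algebraMap_eq, ← map_mul,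
      Ideal.Quotient.eq_zero_iff_mem] at hy
    exact Ideal.Quotient.eq_zero_iff_mem.mpr ((hpp.mem_or_mem hy).resolve_left hxp)
  have hzero := subsingleton_extRing_of_isSMulRegular hxm hreg 0
    (key _ inferInstance 1 le_rfl)
  have hass : p ∈ associatedPrimes R R :=
    Module.associatedPrimes.minimalPrimes_annihilator_subset_associatedPrimes R R (by
      rwa [Module.annihilator_eq_bot.mpr inferInstance])
  obtain ⟨g, hg⟩ := ((isAssociatedPrime_iff_exists_injective_linearMap _ _).mp hass).2
  rw [linearMap_eq_zero_of_subsingleton_extRing_zero hzero g] at hg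
  exact hpp.ne_top (Ideal.Quotient.subsingleton_iff.mp ⟨fun a b => hg rfl⟩)

/-- An associated prime of `R/(x)` contains the nonzerodivisor `x`, so it is not minimal and must be
`m`. -/
theorem exists_injective_quotSMulTop [Ring.KrullDimLE 1 R] {x : R} (hx : x ∈ maximalIdeal R)
    (hreg : x ∈ nonZeroDivisors R) :
    ∃ f : (R ⧸ maximalIdeal R) →ₗ[R] (R ⧸ Ideal.span {x}), Function.Injective f := by
  have : Nontrivial (R ⧸ Ideal.span {x}) := Ideal.Quotient.nontrivial_iff.mpr fun h =>
    (mem_maximalIdeal x).mp hx (Ideal.span_singleton_eq_top.mp h)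
  obtain ⟨p, hp⟩ := associatedPrimes.nonempty R (R ⧸ Ideal.span {x})
  have hxp : x ∈ p := by
    refine hp.annihilator_le ?_
    rw [Submodule.annihilator_top, Ideal.annihilator_quotient]
    exact Ideal.mem_span_singleton_self x
  obtain ⟨hpp, hf⟩ := (isAssociatedPrime_iff_exists_injective_linearMap _ _).mp hp
  rcases Ring.krullDimLE_one_iff.mp ‹_› p hpp with h | h
  · exact absurd hreg (Set.disjoint_left.mp (Ideal.disjoint_nonZeroDivisors_of_mem_minimalPrimes h) hxp)
  · rwa [← eq_maximalIdeal h]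

/-- `y` lifts a nonzero socle element of `R/(x)`, the image of `1` under the embedding of `k`. -/
theorem exists_notMem_span_singleton [Ring.KrullDimLE 1 R] {x : R} (hx : x ∈ maximalIdeal R)
    (hreg : x ∈ nonZeroDivisors R) :
    ∃ y ∉ Ideal.span {x}, ∀ z ∈ maximalIdeal R, z * y ∈ Ideal.span {x} := by
  obtain ⟨f, hf⟩ := exists_injective_quotSMulTop hx hreg
  obtain ⟨y, hy⟩ := Ideal.Quotient.mk_surjective (f (Ideal.Quotient.mk _ 1))
  refine ⟨y, fun h => ?_, fun z hz => ?_⟩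
  · rw [Ideal.Quotient.eq_zero_iff_mem.mpr h, eq_comm, map_eq_zero_iff f hf,
      Ideal.Quotient.eq_zero_iff_mem] at hy
    exact (Ideal.ne_top_iff_one _).mp (maximalIdeal.isMaximal R).ne_top hy
  · rw [← Ideal.Quotient.eq_zero_iff_mem, map_mul, hy, ← Ideal.Quotient.algebraMap_eq,
      ← Algebra.smul_def, ← map_smul, Algebra.smul_def, Ideal.Quotient.algebraMap_eq, ← map_mul,
      mul_one, Ideal.Quotient.eq_zero_iff_mem.mpr hz, map_zero]

/-- A one-dimensional Gorenstein local ring has injective dimension at most one. -/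
theorem subsingleton_extRing_of_two_le (hdim : ringKrullDim R = 1) {n : ℕ}
    (hn : ∀ (N : Type u) [AddCommGroup N] [Module R N], Module.Finite R N → ∀ j, n ≤ j →
      Subsingleton (ExtRing (R := R) N j))
    (N : Type u) [AddCommGroup N] [Module R N] (hfin : Module.Finite R N) (j : ℕ) (hj : 2 ≤ j) :
    Subsingleton (ExtRing (R := R) N j) := by
  have hdim1 : Ring.KrullDimLE 1 R := (Order.krullDimLE_iff 1 _).mpr hdim.le
  obtain ⟨x, hx, hreg⟩ := exists_mem_maximalIdeal_nonZeroDivisors hdim hn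
  obtain ⟨f, hf⟩ := exists_injective_quotSMulTop hx hreg
  -- `R/(x)` contains `k`, and `0 → R → R → R/(x) → 0` kills its `Ext` in degrees at least two.
  refine subsingleton_extRing_of_injective_residueField (r := 2) hn f hf (fun j hj => ?_) N hfin j hj
  obtain ⟨i, rfl⟩ := Nat.exists_eq_add_of_le' hj
  refine subsingleton_extRing_right (f := LinearMap.mulLeft R x) (g := (Ideal.span {x}).mkQ)
    ?_ (Submodule.mkQ_surjective _) ?_ (i + 1) (subsingleton_extRing_of_projective _ (by omega))
    (subsingleton_extRing_of_projective _ (by omega))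
  · exact (injective_iff_map_eq_zero _).mpr fun a ha => (mem_nonZeroDivisors_iff.mp hreg).1 a ha
  · intro a
    rw [Submodule.mkQ_apply, Submodule.Quotient.mk_eq_zero, Ideal.mem_span_singleton']
    simp [mul_comm]

end Gorenstein

/-! ### Totally reflexive modules. -/

section TotallyReflexive

variable {R : Type u} [CommRing R]

theorem isTotallyReflexive_of_subsingleton (G : Type u) [AddCommGroup G] [Module R G]
    [Subsingleton G] : IsTotallyReflexive R G where
  finite := inferInstance
  eval_bijective := ⟨fun _ _ _ => Subsingleton.elim _ _, fun φ => ⟨0, by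
    ext g
    rw [Subsingleton.elim g 0, map_zero, map_zero]⟩⟩
  ext_eq_zero i _ := subsingleton_extRing_of_subsingleton i
  ext_dual_eq_zero i _ := subsingleton_extRing_of_subsingleton i

theorem isTotallyReflexive_of_projective (G : Type u) [AddCommGroup G] [Module R G]
    [Module.Finite R G] [Module.Projective R G] : IsTotallyReflexive R G where
  finite := inferInstance
  eval_bijective := Module.bijective_dual_eval R G
  ext_eq_zero i hi := subsingleton_extRing_of_projective i hi
  ext_dual_eq_zero i hi := subsingleton_extRing_of_projective i hi

/-- Dual modules of finitely generated modules embed in finite free modules. -/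
theorem exists_injective_dual (G : Type u) [AddCommGroup G] [Module R G] [Module.Finite R G] :
    ∃ (n : ℕ) (f : Module.Dual R G →ₗ[R] (Fin n → R)), Function.Injective f := by
  obtain ⟨n, π, hπ⟩ := Module.Finite.exists_fin' R G
  exact ⟨n, (LinearEquiv.piRing R R (Fin n) R).toLinearMap ∘ₗ π.dualMap,
    (LinearEquiv.piRing R R (Fin n) R).injective.comp (LinearMap.dualMap_injective_of_surjective hπ)⟩

theorem subsingleton_extRing_of_injective_pi
    (h2 : ∀ (N : Type u) [AddCommGroup N] [Module R N], Module.Finite R N → ∀ j, 2 ≤ j →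
      Subsingleton (ExtRing (R := R) N j))
    {G : Type u} [AddCommGroup G] [Module R G] {n : ℕ} (f : G →ₗ[R] (Fin n → R))
    (hf : Function.Injective f) (i : ℕ) (hi : 0 < i) : Subsingleton (ExtRing (R := R) G i) :=
  subsingleton_extRing_left hf (Submodule.mkQ_surjective _) (LinearMap.exact_map_mkQ_range f) i
    (subsingleton_extRing_of_projective i hi) (h2 _ inferInstance _ (by omega))

/-- Over a Noetherian ring of injective dimension at most one, finitely generated submodules of
free modules are totally reflexive. -/
theorem isTotallyReflexive_of_injective_pi [IsNoetherianRing R]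
    (h2 : ∀ (N : Type u) [AddCommGroup N] [Module R N], Module.Finite R N → ∀ j, 2 ≤ j →
      Subsingleton (ExtRing (R := R) N j))
    {G : Type u} [AddCommGroup G] [Module R G] [hfin : Module.Finite R G] {n : ℕ}
    (f : G →ₗ[R] (Fin n → R)) (hf : Function.Injective f) : IsTotallyReflexive R G where
  finite := hfin
  eval_bijective := by
    refine ⟨(injective_iff_map_eq_zero _).mpr fun g hg => ?_, fun φ => ?_⟩
    · refine (injective_iff_map_eq_zero _).mp hf g (funext fun i => ?_)
      exact LinearMap.congr_fun hg (LinearMap.proj i ∘ₗ f)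
    -- With `K = ker π`, the sequence `0 → G* → (R^m)* → K* → 0` is exact because `Ext^1(G, R) = 0`.
    -- Since `K*` embeds in a free module, `Ext^1(K*, R) = 0`, so `φ` extends to `(R^m)*`, where it
    -- is evaluation at some `v`.
    · obtain ⟨m, π, hπ⟩ := Module.Finite.exists_fin' R G
      have hG1 := subsingleton_extRing_of_injective_pi h2 f hf 1 one_pos
      have hexact : Function.Exact (LinearMap.ker π).subtype π := fun y => by simp
      have : Module.Finite R (LinearMap.ker π) := inferInstance
      obtain ⟨k, e, he⟩ := exists_injective_dual (R := R) (LinearMap.ker π)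
      have hK1 := subsingleton_extRing_of_injective_pi h2 e he 1 one_pos
      obtain ⟨ψ, hψ⟩ := exists_extend_of_subsingleton_extRing_one (f := π.dualMap)
        (g := (LinearMap.ker π).subtype.dualMap)
        (LinearMap.dualMap_injective_of_surjective hπ)
        (fun α => exists_extend_of_subsingleton_extRing_one (Submodule.injective_subtype _) hπ
          hexact hG1 α)
        (fun β => by
          rw [← LinearMap.coe_range, SetLike.mem_coe,
            LinearMap.range_dualMap_eq_dualAnnihilator_ker_of_surjective π hπ,
            Submodule.mem_dualAnnihilator]
          exact ⟨fun h v hv => LinearMap.congr_fun h ⟨v, hv⟩, fun h => LinearMap.ext fun v => h v v.2⟩)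
        hK1 φ
      obtain ⟨v, rfl⟩ := (Module.bijective_dual_eval R (Fin m → R)).2 ψ
      exact ⟨π v, hψ⟩
  ext_eq_zero := subsingleton_extRing_of_injective_pi h2 f hf
  ext_dual_eq_zero := by
    obtain ⟨n, e, he⟩ := exists_injective_dual (R := R) G
    exact subsingleton_extRing_of_injective_pi h2 e he

end TotallyReflexive

/-! ### Two-term proper resolutions. -/

section TwoTerm

variable {R : Type u} [CommRing R] {E M : Type u} [AddCommGroup E] [Module R E]
  [AddCommGroup M] [Module R M]

variable (R E) in
/-- The terms of the complex `⋯ → 0 → 0 → R → E`. -/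
def twoTermX : ℕ → ModuleCat.{u} R
  | 0 => ModuleCat.of R E
  | 1 => ModuleCat.of R R
  | _ + 2 => ModuleCat.of R PUnit

/-- The differentials of the complex `⋯ → 0 → 0 → R → E`. -/
def twoTermD (f : R →ₗ[R] E) : ∀ n, twoTermX R E (n + 1) ⟶ twoTermX R E n
  | 0 => ModuleCat.ofHom f
  | _ + 1 => 0

/-- The complex `⋯ → 0 → 0 → R → E`. -/
def twoTerm (f : R →ₗ[R] E) : ChainComplex (ModuleCat.{u} R) ℕ :=
  ChainComplex.of (twoTermX R E) (twoTermD f) fun n => by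
    cases n <;> exact Limits.zero_comp

theorem subsingleton_twoTerm_X (f : R →ₗ[R] E) (n : ℕ) : Subsingleton ((twoTerm f).X (n + 2)) :=
  inferInstanceAs (Subsingleton PUnit)

theorem twoTerm_d_one (f : R →ₗ[R] E) : (twoTerm f).d 1 0 = ModuleCat.ofHom f :=
  ChainComplex.of_d (twoTermX R E) (twoTermD f) 0

theorem twoTerm_d_one_hom (f : R →ₗ[R] E) : ((twoTerm f).d 1 0).hom = f :=
  congrArg ModuleCat.Hom.hom (twoTerm_d_one f)

/-- The proper resolution `0 → R → E → M → 0` with `E` totally reflexive. -/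
def twoTermProperResolution {f : R →ₗ[R] E} {g : E →ₗ[R] M} (hf : Function.Injective f)
    (hg : Function.Surjective g) (hfg : Function.Exact f g) (hE : IsTotallyReflexive R E) :
    ProperResolution R M where
  T := twoTerm f
  ε := g
  exact_succ n := by
    have := subsingleton_twoTerm_X f n
    cases n with
    | zero =>
      intro y
      rw [twoTerm_d_one_hom]
      refine ⟨fun h => ⟨0, ?_⟩, ?_⟩
      · rw [map_zero]
        exact (hf (h.trans (map_zero f).symm)).symm
      · rintro ⟨z, rfl⟩
        rw [Subsingleton.elim z 0, map_zero]
        exact map_zero f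
    | succ n =>
      have h1 := subsingleton_twoTerm_X f n
      exact fun y => ⟨fun _ => ⟨0, h1.elim _ _⟩, fun _ => by rw [h1.elim y 0, map_zero]⟩
  exact_zero := by
    rw [twoTerm_d_one_hom]
    exact hfg
  surjective := hg
  totallyReflexive n := by
    match n with
    | 0 => exact hE
    | 1 => exact isTotallyReflexive_of_projective (R := R) R
    | n + 2 =>
      have := subsingleton_twoTerm_X f n
      exact isTotallyReflexive_of_subsingleton _
  hom_exact_succ G _ _ hG n := by
    have := subsingleton_twoTerm_X f n
    cases n with
    | zero =>
      intro φ
      rw [twoTerm_d_one_hom]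
      refine ⟨fun h => ⟨0, ?_⟩, ?_⟩
      · ext x
        exact (hf ((LinearMap.congr_fun h x).trans (map_zero f).symm)).symm
      · rintro ⟨z, rfl⟩
        ext x
        have : z x = 0 := Subsingleton.elim _ _
        change f (((twoTerm f).d 2 1).hom (z x)) = 0
        rw [this, map_zero]
        exact map_zero f
    | succ n =>
      have h1 := subsingleton_twoTerm_X f n
      have h2 : Subsingleton (G →ₗ[R] (twoTerm f).X (n + 1 + 1)) :=
        ⟨fun a b => LinearMap.ext fun x => h1.elim _ _⟩
      exact fun y => ⟨fun _ => ⟨0, h2.elim _ _⟩, fun _ => by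
        rw [h2.elim y 0]
        exact LinearMap.comp_zero _⟩
  hom_exact_zero G _ _ hG := by
    intro φ
    rw [twoTerm_d_one_hom]
    refine ⟨fun h => ?_, ?_⟩
    · have hmem : ∀ x, φ x ∈ LinearMap.range f := fun x =>
        (hfg (φ x)).mp (LinearMap.congr_fun h x)
      refine ⟨(LinearEquiv.ofInjective f hf).symm.toLinearMap ∘ₗ φ.codRestrict _ hmem, ?_⟩
      ext x
      exact congrArg Subtype.val
        ((LinearEquiv.ofInjective f hf).apply_symm_apply (φ.codRestrict _ hmem x))
    · rintro ⟨z, rfl⟩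
      ext x
      exact (hfg _).mpr ⟨z x, rfl⟩
  -- The kernel of `g` is `R`, so the obstruction to lifting lies in `Ext^1(G, R) = 0`.
  hom_surjective G _ _ hG φ :=
    exists_lift_of_subsingleton_extRing_one hf hg hfg (hG.ext_eq_zero 1 one_pos) φ

end TwoTerm

/-! ### Comparison of proper resolutions. -/

namespace ProperResolution

variable {R : Type u} [CommRing R] {M : Type u} [AddCommGroup M] [Module R M]

/-- Properness lets totally reflexive modules play the role of projectives in the usual comparison
argument. -/
theorem exists_lift_succ (P : ProperResolution R M) {G : ModuleCat.{u} R}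
    (hG : IsTotallyReflexive R G) (n : ℕ) (φ : G ⟶ P.T.X (n + 1))
    (hφ : φ ≫ P.T.d (n + 1) n = 0) : ∃ ψ : G ⟶ P.T.X (n + 2), ψ ≫ P.T.d (n + 2) (n + 1) = φ := by
  obtain ⟨ψ, hψ⟩ := (P.hom_exact_succ G hG n φ.hom).mp (congrArg ModuleCat.Hom.hom hφ)
  exact ⟨ModuleCat.ofHom ψ, ModuleCat.hom_ext hψ⟩

theorem exists_lift_zero (P : ProperResolution R M) {G : ModuleCat.{u} R}
    (hG : IsTotallyReflexive R G) (φ : G ⟶ P.T.X 0) (hφ : P.ε ∘ₗ φ.hom = 0) :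
    ∃ ψ : G ⟶ P.T.X 1, ψ ≫ P.T.d 1 0 = φ := by
  obtain ⟨ψ, hψ⟩ := (P.hom_exact_zero G hG φ.hom).mp hφ
  exact ⟨ModuleCat.ofHom ψ, ModuleCat.hom_ext hψ⟩

theorem exists_lift_augmentation (P : ProperResolution R M) {G : ModuleCat.{u} R}
    (hG : IsTotallyReflexive R G) (φ : G →ₗ[R] M) :
    ∃ ψ : G ⟶ P.T.X 0, P.ε ∘ₗ ψ.hom = φ := by
  obtain ⟨ψ, hψ⟩ := P.hom_surjective G hG φ
  exact ⟨ModuleCat.ofHom ψ, hψ⟩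

theorem augmentation_comp_d (P : ProperResolution R M) : P.ε ∘ₗ (P.T.d 1 0).hom = 0 :=
  P.exact_zero.linearMap_comp_eq_zero

/-- Chain maps between proper resolutions that lift the identity exist. -/
theorem exists_hom (P Q : ProperResolution R M) :
    ∃ f : P.T ⟶ Q.T, Q.ε ∘ₗ (f.f 0).hom = P.ε := by
  obtain ⟨f₀, h₀⟩ := Q.exists_lift_augmentation (P.totallyReflexive 0) P.ε
  have h₁ : ∃ f₁ : P.T.X 1 ⟶ Q.T.X 1, f₁ ≫ Q.T.d 1 0 = P.T.d 1 0 ≫ f₀ :=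
    Q.exists_lift_zero (P.totallyReflexive 1) _ (by
      rw [ModuleCat.hom_comp, ← LinearMap.comp_assoc, h₀, P.augmentation_comp_d])
  refine ⟨ChainComplex.mkHom P.T Q.T f₀ h₁.choose h₁.choose_spec fun n p => ?_, h₀⟩
  have h := Q.exists_lift_succ (P.totallyReflexive (n + 2)) n (P.T.d (n + 2) (n + 1) ≫ p.2.1) (by
    rw [Category.assoc, p.2.2, P.T.d_comp_d_assoc, Limits.zero_comp])
  exact ⟨h.choose, h.choose_spec⟩

/-- A chain map between proper resolutions that lifts zero is null-homotopic. -/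
theorem nonempty_homotopy_zero (P Q : ProperResolution R M) (e : P.T ⟶ Q.T)
    (he : Q.ε ∘ₗ (e.f 0).hom = 0) : Nonempty (Homotopy e 0) := by
  obtain ⟨h₀, hh₀⟩ := Q.exists_lift_zero (P.totallyReflexive 0) (e.f 0) he
  obtain ⟨h₁, hh₁⟩ := Q.exists_lift_succ (P.totallyReflexive 1) 0 (e.f 1 - P.T.d 1 0 ≫ h₀) (by
    rw [Preadditive.sub_comp, Category.assoc, hh₀, e.comm, sub_self])
  refine ⟨Homotopy.mkInductive e h₀ hh₀.symm h₁ (by rw [hh₁]; abel) fun n p => ?_⟩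
  have h := Q.exists_lift_succ (P.totallyReflexive (n + 2)) (n + 1)
    (e.f (n + 2) - P.T.d (n + 2) (n + 1) ≫ p.2.1) (by
      rw [Preadditive.sub_comp, Category.assoc, e.comm, eq_sub_of_add_eq' p.2.2.symm,
        Preadditive.comp_sub, P.T.d_comp_d_assoc, Limits.zero_comp, sub_zero, sub_self])
  exact ⟨h.choose, by rw [h.choose_spec]; abel⟩

theorem nonempty_homotopy_id (P : ProperResolution R M) (f : P.T ⟶ P.T)
    (hf : P.ε ∘ₗ (f.f 0).hom = P.ε) : Nonempty (Homotopy f (𝟙 P.T)) := by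
  obtain ⟨h⟩ := P.nonempty_homotopy_zero P (f - 𝟙 P.T) (by
    rw [HomologicalComplex.sub_f_apply, ModuleCat.hom_sub, LinearMap.comp_sub, hf,
      HomologicalComplex.id_f, ModuleCat.hom_id, LinearMap.comp_id, sub_self])
  exact ⟨Homotopy.equivSubZero.symm h⟩

/-- Any two proper resolutions are homotopy equivalent. -/
theorem nonempty_homotopyEquiv (P Q : ProperResolution R M) :
    Nonempty (HomotopyEquiv P.T Q.T) := by
  obtain ⟨f, hf⟩ := P.exists_hom Q
  obtain ⟨g, hg⟩ := Q.exists_hom P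
  obtain ⟨h₁⟩ := P.nonempty_homotopy_id (f ≫ g) (by
    rw [HomologicalComplex.comp_f, ModuleCat.hom_comp, ← LinearMap.comp_assoc, hg, hf])
  obtain ⟨h₂⟩ := Q.nonempty_homotopy_id (g ≫ f) (by
    rw [HomologicalComplex.comp_f, ModuleCat.hom_comp, ← LinearMap.comp_assoc, hf, hg])
  exact ⟨⟨f, g, h₁, h₂⟩⟩

end ProperResolution

/-! ### Relative homology. -/

variable {R : Type u} [CommRing R] {M : Type u} [AddCommGroup M] [Module R M]

/-- Relative homology does not depend on the proper resolution. -/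
theorem nonempty_gTor_iso (P Q : ProperResolution R M) (N : Type u) [AddCommGroup N] [Module R N]
    (i : ℕ) : Nonempty (GTor P N i ≅ GTor Q N i) := by
  obtain ⟨e⟩ := P.nonempty_homotopyEquiv Q
  exact ⟨((tensorRight (ModuleCat.of R N)).mapHomotopyEquiv e).toHomologyIso i⟩

theorem subsingleton_gTor_iff (P : ProperResolution R M) (N : Type u) [AddCommGroup N] [Module R N]
    (n : ℕ) : Subsingleton (GTor P N (n + 1)) ↔
      Function.Exact ((P.T.d (n + 2) (n + 1)).hom.rTensor N) ((P.T.d (n + 1) n).hom.rTensor N) := by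
  rw [GTor, ← ModuleCat.isZero_iff_subsingleton, ← HomologicalComplex.exactAt_iff_isZero_homology,
    HomologicalComplex.exactAt_iff' _ (n + 2) (n + 1) n (by simp) (by simp),
    ShortComplex.ShortExact.moduleCat_exact_iff_function_exact]
  rfl

/-- `GTor_0(M, N)` surjects onto `M ⊗ N`. -/
theorem nontrivial_gTor_zero (P : ProperResolution R M) (N : Type u) [AddCommGroup N] [Module R N]
    [Nontrivial (TensorProduct R M N)] : Nontrivial (GTor P N 0) := by
  by_contra h
  rw [not_nontrivial_iff_subsingleton, GTor, ← ModuleCat.isZero_iff_subsingleton,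
    ← HomologicalComplex.exactAt_iff_isZero_homology,
    HomologicalComplex.exactAt_iff' _ 1 0 0 (by simp) (by simp),
    ShortComplex.ShortExact.moduleCat_exact_iff_function_exact] at h
  obtain ⟨z, hz⟩ := exists_ne (0 : TensorProduct R M N)
  obtain ⟨w, rfl⟩ := LinearMap.rTensor_surjective N P.surjective z
  -- Degree `0` has no successor, so the outgoing differential is the zero map `d 0 0`.
  have hw : ((P.T.d 0 0).hom.rTensor N) w = 0 := by
    rw [P.T.shape 0 0 (by simp)]
    simp
  obtain ⟨v, rfl⟩ : ∃ v, ((P.T.d 1 0).hom.rTensor N) v = w := (h w).mp hw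
  apply hz
  rw [← LinearMap.rTensor_comp_apply, P.augmentation_comp_d]
  simp

open IsLocalRing

/-! ### Depth and the value of `t(k, k)`. -/

section Depth

variable {R : Type u} [CommRing R] [IsLocalRing R] {M : Type u} [AddCommGroup M] [Module R M]

theorem depth_eq_zero_of_maximalIdeal_le_annihilator [Nontrivial M]
    (h : maximalIdeal R ≤ Module.annihilator R M) : depth R M = 0 := by
  refine le_antisymm (iSup_le fun rs => iSup₂_le fun hrs hreg => ?_) (zero_le)
  cases rs with
  | nil => simp
  | cons r rs =>
    exfalso
    obtain ⟨z, hz⟩ := exists_ne (0 : M)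
    have hr := ((RingTheory.Sequence.isWeaklyRegular_cons_iff M r rs).mp hreg).1
    exact hz (hr.right_eq_zero_of_smul
      (Module.mem_annihilator.mp (h (hrs r List.mem_cons_self)) z))

/-- A regular sequence lowers the dimension of the support by its length. -/
theorem depth_le_of_ringKrullDim_le [IsNoetherianRing R] [Nontrivial M] [Module.Finite R M]
    {n : ℕ} (hdim : ringKrullDim R ≤ n) : depth R M ≤ n := by
  refine iSup_le fun rs => iSup₂_le fun hrs hreg => ?_
  have hreg' : RingTheory.Sequence.IsRegular M rs :=
    (isRegular_iff_isWeaklyRegular_of_subset_maximalIdeal hrs).mpr hreg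
  have h := Module.supportDim_add_length_eq_supportDim_of_isRegular rs hreg'
  have hnon : Nontrivial (M ⧸ Ideal.ofList rs • (⊤ : Submodule R M)) :=
    Submodule.Quotient.nontrivial_iff.mpr hreg'.top_ne_smul.symm
  have h0 : 0 ≤ Module.supportDim R (M ⧸ Ideal.ofList rs • (⊤ : Submodule R M)) := by
    have hne := Module.supportDim_ne_bot_of_nontrivial (R := R)
      (M := M ⧸ Ideal.ofList rs • (⊤ : Submodule R M))
    obtain ⟨a, ha⟩ := WithBot.ne_bot_iff_exists.mp hne
    rw [← ha]
    exact WithBot.coe_le_coe.mpr zero_le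
  have hle : ((rs.length : ℕ) : WithBot ℕ∞) ≤ n :=
    calc ((rs.length : ℕ) : WithBot ℕ∞) ≤
          Module.supportDim R (M ⧸ Ideal.ofList rs • (⊤ : Submodule R M)) + rs.length :=
            le_add_of_nonneg_left h0
      _ = Module.supportDim R M := h
      _ ≤ ringKrullDim R := Module.supportDim_le_ringKrullDim R M
      _ ≤ n := hdim
  exact_mod_cast hle

theorem one_le_depth_of_isSMulRegular {x : R} (hx : x ∈ maximalIdeal R) (hreg : IsSMulRegular M x) :
    1 ≤ depth R M := by
  refine le_iSup_of_le [x] (le_iSup₂_of_le (by simpa using hx) ?_ (by simp))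
  simpa [RingTheory.Sequence.isWeaklyRegular_cons_iff] using hreg

end Depth

section DepthAt

variable {R : Type u} [CommRing R] [IsLocalRing R]

theorem depthAt_closedPoint_residueField : depthAt R (ResidueField R) (closedPoint R) = 0 := by
  have hker : ∀ a ∈ maximalIdeal R, ∀ z : ResidueField R, a • z = 0 := fun a ha z => by
    rw [Algebra.smul_def, ResidueField.algebraMap_eq, (residue_eq_zero_iff a).mpr ha, zero_mul]
  have hann : maximalIdeal (Localization.AtPrime (closedPoint R).asIdeal) ≤
      Module.annihilator (Localization.AtPrime (closedPoint R).asIdeal)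
        (LocalizedModule (closedPoint R).asIdeal.primeCompl (ResidueField R)) := by
    rw [← Localization.AtPrime.map_eq_maximalIdeal, Ideal.map_le_iff_le_comap]
    intro a ha
    rw [Ideal.mem_comap, Module.mem_annihilator]
    intro z
    induction z using LocalizedModule.induction_on with
    | _ v t => rw [algebraMap_smul, LocalizedModule.smul'_mk, hker a ha, LocalizedModule.zero_mk]
  have : Nontrivial
      (LocalizedModule (closedPoint R).asIdeal.primeCompl (ResidueField R)) := by
    refine ⟨LocalizedModule.mk 1 1, 0, fun h => ?_⟩
    rw [← LocalizedModule.zero_mk 1, LocalizedModule.mk_eq] at h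
    obtain ⟨u, hu⟩ := h
    simp only [one_smul, smul_zero, Submonoid.smul_def] at hu
    rw [Algebra.smul_def, mul_one, ResidueField.algebraMap_eq, residue_eq_zero_iff] at hu
    exact u.2 hu
  exact depth_eq_zero_of_maximalIdeal_le_annihilator hann

theorem depthAt_closedPoint_self [IsNoetherianRing R] (hdim : ringKrullDim R = 1) {x : R}
    (hx : x ∈ maximalIdeal R) (hreg : x ∈ nonZeroDivisors R) :
    depthAt R R (closedPoint R) = 1 := by
  let S := Localization.AtPrime (closedPoint R).asIdeal
  have : Nontrivial (LocalizedModule (closedPoint R).asIdeal.primeCompl R) :=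
    inferInstanceAs (Nontrivial S)
  let e : R ≃ₐ[R] S := IsLocalization.atUnits R (closedPoint R).asIdeal.primeCompl
    (fun y hy => notMem_maximalIdeal.mp hy)
  have hS : ringKrullDim S ≤ (1 : ℕ) := by
    rw [← ringKrullDim_eq_of_ringEquiv e.toRingEquiv, hdim]
    rfl
  refine le_antisymm (depth_le_of_ringKrullDim_le hS) ?_
  refine one_le_depth_of_isSMulRegular (x := algebraMap R S x) ?_ ?_
  · rw [← Localization.AtPrime.map_eq_maximalIdeal]
    exact Ideal.mem_map_of_mem _ hx
  · have hw : RingTheory.Sequence.IsWeaklyRegular R [x] := by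
      simpa [RingTheory.Sequence.isWeaklyRegular_cons_iff] using
        Module.Flat.isSMulRegular_of_nonZeroDivisors hreg
    have := hw.of_isLocalizedModule S (closedPoint R).asIdeal.primeCompl
      (LocalizedModule.mkLinearMap (closedPoint R).asIdeal.primeCompl R)
    simpa [RingTheory.Sequence.isWeaklyRegular_cons_iff] using this

instance : Nontrivial (TensorProduct R (ResidueField R) (ResidueField R)) := by
  let μ : TensorProduct R (ResidueField R) (ResidueField R) →ₗ[R] ResidueField R :=
    LinearMap.mul' R (ResidueField R)
  exact ⟨1, 0, fun h => one_ne_zero (α := ResidueField R) (by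
    simpa [μ, Algebra.TensorProduct.one_def] using congrArg μ h)⟩

theorem t_residueField [IsNoetherianRing R] (hdim : ringKrullDim R = 1) {x : R}
    (hx : x ∈ maximalIdeal R) (hreg : x ∈ nonZeroDivisors R) :
    t R (ResidueField R) (ResidueField R) = 1 := by
  have hval : ((depthAt R R (closedPoint R) : EReal) -
      (depthAt R (ResidueField R) (closedPoint R) : EReal) -
      (depthAt R (ResidueField R) (closedPoint R) : EReal)) = 1 := by
    rw [depthAt_closedPoint_residueField, depthAt_closedPoint_self hdim hx hreg]
    norm_num
  have hsupp : ∀ p ∈ Module.support R (TensorProduct R (ResidueField R) (ResidueField R)),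
      p = closedPoint R := by
    intro p hp
    have hle : maximalIdeal R ≤ p.asIdeal := fun a ha => by
      refine Module.annihilator_le_of_mem_support hp (Module.mem_annihilator.mpr fun z => ?_)
      induction z with
      | zero => rw [smul_zero]
      | add z w hz hw => rw [smul_add, hz, hw, add_zero]
      | tmul z w =>
        rw [TensorProduct.smul_tmul', Algebra.smul_def, ResidueField.algebraMap_eq,
          (residue_eq_zero_iff a).mpr ha, zero_mul, TensorProduct.zero_tmul]
    exact PrimeSpectrum.ext
      ((maximalIdeal.isMaximal R).eq_of_le p.isPrime.ne_top hle).symm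
  refine le_antisymm (iSup₂_le fun p hp => ?_) ?_
  · rw [hsupp p hp, hval]
  · obtain ⟨p, hp⟩ := Module.nonempty_support_of_nontrivial (R := R)
      (M := TensorProduct R (ResidueField R) (ResidueField R))
    exact le_iSup₂_of_le p hp (by rw [hsupp p hp, hval])

end DepthAt

/-! ### The ideal `(x, y)` and the residue field. -/

section ResidueField

variable {R : Type u} [CommRing R] {x y : R}

/-- Multiplication by `x`, as a map into the ideal `(x, y)`. -/
def mulToSpanPair (x y : R) : R →ₗ[R] Ideal.span {x, y} :=
  LinearMap.toSpanSingleton R _ ⟨x, Ideal.subset_span (by simp)⟩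

theorem mulToSpanPair_injective (hreg : x ∈ nonZeroDivisors R) :
    Function.Injective (mulToSpanPair x y) :=
  (injective_iff_map_eq_zero _).mpr fun a ha =>
    (mem_nonZeroDivisors_iff.mp hreg).2 a (congrArg Subtype.val ha)

theorem mem_range_mulToSpanPair {z : Ideal.span {x, y}} :
    z ∈ LinearMap.range (mulToSpanPair x y) ↔ (z : R) ∈ Ideal.span {x} := by
  rw [Ideal.mem_span_singleton', LinearMap.mem_range]
  exact exists_congr fun a => Subtype.ext_iff

variable [IsLocalRing R]

/-- If `m y ⊆ (x)` and `y ∉ (x)`, then `(x, y) / (x)` is the residue field. -/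
theorem exists_spanPair_to_residueField (hy : y ∉ Ideal.span {x})
    (hxy : ∀ z ∈ maximalIdeal R, z * y ∈ Ideal.span {x}) :
    ∃ g : Ideal.span {x, y} →ₗ[R] ResidueField R, Function.Surjective g ∧
      Function.Exact (mulToSpanPair x y) g := by
  let q := (LinearMap.range (mulToSpanPair x y)).mkQ
  let h : R →ₗ[R] _ := q ∘ₗ
    LinearMap.toSpanSingleton R (Ideal.span {x, y}) ⟨y, Ideal.subset_span (by simp)⟩
  have hh (r : R) : h r = 0 ↔ r * y ∈ Ideal.span {x} := by
    simp only [h, q, LinearMap.comp_apply, Submodule.mkQ_apply, Submodule.Quotient.mk_eq_zero]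
    exact mem_range_mulToSpanPair
  -- The map `h` sends `r` to the class of `r y`; its kernel contains `m` and omits `1`.
  have hker : LinearMap.ker h = maximalIdeal R := by
    refine ((maximalIdeal.isMaximal R).eq_of_le ?_ fun z hz => ?_).symm
    · rw [Ideal.ne_top_iff_one, LinearMap.mem_ker, hh, one_mul]
      exact hy
    · rw [LinearMap.mem_ker, hh]
      exact hxy z hz
  have hsurj : Function.Surjective h := by
    intro w
    obtain ⟨⟨w, hw⟩, rfl⟩ := Submodule.mkQ_surjective _ w
    obtain ⟨a, b, rfl⟩ := Ideal.mem_span_pair.mp hw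
    refine ⟨b, ?_⟩
    rw [LinearMap.comp_apply, ← sub_eq_zero, ← map_sub, Submodule.mkQ_apply,
      Submodule.Quotient.mk_eq_zero, mem_range_mulToSpanPair, Ideal.mem_span_singleton']
    exact ⟨-a, by simp⟩
  let e : ResidueField R ≃ₗ[R] _ :=
    (Submodule.quotEquivOfEq _ _ hker.symm : (R ⧸ maximalIdeal R) ≃ₗ[R] _).trans
      (h.quotKerEquivOfSurjective hsurj)
  refine ⟨e.symm.toLinearMap ∘ₗ q, e.symm.surjective.comp (Submodule.mkQ_surjective _), ?_⟩
  intro z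
  rw [← LinearMap.coe_range, SetLike.mem_coe, LinearMap.comp_apply, LinearEquiv.coe_coe,
    e.symm.map_eq_zero_iff, Submodule.mkQ_apply, Submodule.Quotient.mk_eq_zero]

/-- Write `x = a x + b y` with `a, b ∈ m`. As `1 - a` is a unit, `x = b' y` with `b' ∈ m`, so `y` is
a nonzerodivisor. For `z ∈ m`, `z y = d x = d b' y` gives `z = d b'`. -/
theorem maximalIdeal_eq_span_singleton (hreg : x ∈ nonZeroDivisors R)
    (hxy : ∀ z ∈ maximalIdeal R, z * y ∈ Ideal.span {x})
    (h : x ∈ maximalIdeal R * Ideal.span {x, y}) : ∃ b, maximalIdeal R = Ideal.span {b} := by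
  rw [Ideal.span_insert, Ideal.mul_sup, Submodule.mem_sup] at h
  obtain ⟨u, hu, v, hv, huv⟩ := h
  obtain ⟨a, ha, rfl⟩ := Ideal.mem_mul_span_singleton.mp hu
  obtain ⟨b, hb, rfl⟩ := Ideal.mem_mul_span_singleton.mp hv
  obtain ⟨c, hc⟩ : IsUnit (1 - a) :=
    (isUnit_or_isUnit_one_sub_self a).resolve_left ((mem_maximalIdeal a).mp ha)
  have hxb : x = (↑c⁻¹ * b) * y := by
    have : (c : R) * x = b * y := by rw [hc]; linear_combination -huv
    rw [mul_assoc, ← this, Units.inv_mul_cancel_left]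
  have hyreg : y ∈ nonZeroDivisors R := by
    rw [hxb] at hreg
    exact (mul_mem_nonZeroDivisors.mp hreg).2
  refine ⟨↑c⁻¹ * b, le_antisymm (fun z hz => ?_) ?_⟩
  · obtain ⟨d, hd⟩ := Ideal.mem_span_singleton'.mp (hxy z hz)
    refine Ideal.mem_span_singleton'.mpr ⟨d, ?_⟩
    refine sub_eq_zero.mp ((mem_nonZeroDivisors_iff.mp hyreg).2 _ ?_)
    linear_combination hd - d * hxb
  · rw [Ideal.span_singleton_le_iff_mem]
    exact Ideal.mul_mem_left _ _ hb

theorem isRegularLocalRing_of_maximalIdeal_eq_span_singleton [IsNoetherianRing R]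
    (hdim : ringKrullDim R = 1) {b : R} (h : maximalIdeal R = Ideal.span {b}) :
    IsRegularLocalRing R := by
  apply IsRegularLocalRing.of_spanFinrank_maximalIdeal_le
  rw [hdim, h, Nat.cast_le_one, ← Set.ncard_singleton b]
  exact Submodule.spanFinrank_span_le_ncard_of_finite (Set.finite_singleton b)

/-- Under `E ⊗ k ≅ E/mE`, with `E = (x, y)`, `1 ⊗ a` goes to the class of `a x`, which is nonzero
for a unit `a`. -/
theorem rTensor_mulToSpanPair_injective (h : x ∉ maximalIdeal R * Ideal.span {x, y}) :
    Function.Injective ((mulToSpanPair x y).rTensor (ResidueField R)) := by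
  refine (injective_iff_map_eq_zero _).mpr fun z hz => ?_
  obtain ⟨c, rfl⟩ := (TensorProduct.lid R (ResidueField R)).symm.surjective z
  obtain ⟨a, rfl⟩ := residue_surjective c
  rw [TensorProduct.lid_symm_apply] at hz ⊢
  by_cases ha : a ∈ maximalIdeal R
  · rw [(residue_eq_zero_iff a).mpr ha, TensorProduct.tmul_zero]
  · exfalso
    have h1 := congrArg (TensorProduct.tensorQuotEquivQuotSMul (Ideal.span {x, y})
      (maximalIdeal R)) hz
    have h2 := (TensorProduct.tensorQuotEquivQuotSMul_tmul_mk (maximalIdeal R)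
      (mulToSpanPair x y 1) a).symm.trans (h1.trans (map_zero _))
    rw [Submodule.Quotient.mk_eq_zero] at h2
    have h3 := Submodule.mem_map_of_mem (f := (Ideal.span {x, y}).subtype) h2
    rw [Submodule.map_smul'', Submodule.map_subtype_top] at h3
    have h4 : a * x ∈ maximalIdeal R * Ideal.span {x, y} := by
      simpa [mulToSpanPair] using h3
    obtain ⟨c, rfl⟩ := notMem_maximalIdeal.mp ha
    exact h ((Ideal.unit_mul_mem_iff_mem _ c.isUnit).mp h4)

/-- If `T₁ = 0`, then `T₀ ≅ k` is killed by the nonzerodivisor `x`; hence `T₀* = 0`, contradicting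
reflexivity. -/
theorem not_subsingleton_X_one (hx : x ∈ maximalIdeal R) (hreg : x ∈ nonZeroDivisors R)
    (P : TRResolution R (ResidueField R)) : ¬ Subsingleton (P.T.X 1) := by
  intro h1
  have hinj : Function.Injective P.ε := (injective_iff_map_eq_zero _).mpr fun z hz => by
    obtain ⟨w, rfl⟩ := (P.exact_zero z).mp hz
    rw [h1.elim w 0, map_zero]
  have hzero : ∀ f : Module.Dual R (P.T.X 0), f = 0 := fun f => by
    ext z
    have hxz : x • z = 0 := hinj (by
      rw [map_smul, map_zero, Algebra.smul_def, ResidueField.algebraMap_eq,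
        (residue_eq_zero_iff x).mpr hx, zero_mul])
    have := congrArg f hxz
    rw [map_smul, map_zero, smul_eq_mul, mul_comm] at this
    exact (mem_nonZeroDivisors_iff.mp hreg).2 _ this
  obtain ⟨z, hz⟩ := P.surjective 1
  have : z = 0 := (P.totallyReflexive 0).eval_bijective.1 (by
    ext f
    rw [hzero f, map_zero, map_zero])
  rw [this, map_zero] at hz
  exact zero_ne_one hz

theorem gDim_residueField (hx : x ∈ maximalIdeal R) (hreg : x ∈ nonZeroDivisors R)
    (P : TRResolution R (ResidueField R)) (h : ∀ i, 1 < i → Subsingleton (P.T.X i)) :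
    GDim R (ResidueField R) = 1 := by
  refine le_antisymm (iInf₂_le_of_le 1 ⟨P, h⟩ (by simp)) (le_iInf₂ ?_)
  rintro n ⟨Q, hQ⟩
  rcases Nat.eq_zero_or_pos n with rfl | hn
  · exact (not_subsingleton_X_one hx hreg Q (hQ 1 one_pos)).elim
  · exact_mod_cast hn

end ResidueField

/-- The invariants of the residue field of a one-dimensional Gorenstein local ring that is not
regular. -/
theorem residueField_of_not_isRegularLocalRing (R : Type u) [CommRing R] [IsGorensteinLocalRing R]
    (hdim : ringKrullDim R = 1) (hR : ¬ IsRegularLocalRing R) :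
    GDim R (ResidueField R) = 1 ∧ t R (ResidueField R) (ResidueField R) = 1 ∧
      Nonempty (ProperResolution R (ResidueField R)) ∧
      ∀ P : ProperResolution R (ResidueField R),
        Subsingleton (GTor P (ResidueField R) 1) ∧ s P (ResidueField R) = 0 := by
  obtain ⟨n, hn⟩ := IsGorensteinLocalRing.finite_injectiveDimension (R := R)
  have hext : ∀ (N : Type u) [AddCommGroup N] [Module R N], Module.Finite R N → ∀ j, n + 1 ≤ j →
      Subsingleton (ExtRing (R := R) N j) :=
    fun N _ _ _ j hj => HasInjectiveDimensionLT.subsingleton _ (n + 1) j hj _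
  obtain ⟨x, hx, hreg⟩ := exists_mem_maximalIdeal_nonZeroDivisors hdim hext
  have hdim1 : Ring.KrullDimLE 1 R := (Order.krullDimLE_iff 1 _).mpr hdim.le
  obtain ⟨y, hy, hxy⟩ := exists_notMem_span_singleton hx hreg
  obtain ⟨g, hg, hfg⟩ := exists_spanPair_to_residueField hy hxy
  have hE : IsTotallyReflexive R (Ideal.span {x, y}) :=
    isTotallyReflexive_of_injective_pi (subsingleton_extRing_of_two_le hdim hext)
      ((LinearEquiv.funUnique (Fin 1) R R).symm.toLinearMap ∘ₗ (Ideal.span {x, y}).subtype)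
      ((LinearEquiv.funUnique (Fin 1) R R).symm.injective.comp (Submodule.injective_subtype _))
  let Q := twoTermProperResolution (mulToSpanPair_injective (y := y) hreg) hg hfg hE
  have hQ : ∀ i, Subsingleton (Q.T.X (i + 2)) := subsingleton_twoTerm_X _
  have hgtor : ∀ i, Subsingleton (GTor Q (ResidueField R) (i + 1)) := by
    intro i
    rw [subsingleton_gTor_iff]
    cases i with
    | zero =>
      have hd : (Q.T.d (0 + 1) 0).hom = mulToSpanPair x y := twoTerm_d_one_hom _
      -- Non-regularity enters here.
      have hnot : x ∉ maximalIdeal R * Ideal.span {x, y} := fun h => by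
        obtain ⟨b, hb⟩ := maximalIdeal_eq_span_singleton hreg hxy h
        exact hR (isRegularLocalRing_of_maximalIdeal_eq_span_singleton hdim hb)
      have hinj : Function.Injective ((Q.T.d (0 + 1) 0).hom.rTensor (ResidueField R)) := by
        rw [hd]
        exact rTensor_mulToSpanPair_injective hnot
      intro z
      refine ⟨fun hz => ⟨0, ?_⟩, ?_⟩
      · rw [map_zero]
        exact ((injective_iff_map_eq_zero _).mp hinj z hz).symm
      · rintro ⟨w, rfl⟩
        rw [← LinearMap.rTensor_comp_apply, ← ModuleCat.hom_comp, Q.T.d_comp_d]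
        simp
    | succ i =>
      have : Subsingleton (TensorProduct R (Q.T.X (i + 1 + 1)) (ResidueField R)) :=
        have := hQ i
        inferInstance
      exact fun z => ⟨fun _ => ⟨0, Subsingleton.elim _ _⟩, fun _ => by
        rw [Subsingleton.elim z 0, map_zero]⟩
  refine ⟨gDim_residueField hx hreg Q.toTRResolution fun i hi => ?_, t_residueField hdim hx hreg,
    ⟨Q⟩, fun P => ?_⟩
  · obtain ⟨j, rfl⟩ := Nat.exists_eq_add_of_le' (show 2 ≤ i from hi)
    exact hQ j
  · have hP : ∀ i, Subsingleton (GTor P (ResidueField R) (i + 1)) := fun i => by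
      obtain ⟨e⟩ := nonempty_gTor_iso P Q (ResidueField R) (i + 1)
      have := hgtor i
      exact e.toLinearEquiv.toEquiv.subsingleton
    refine ⟨hP 0, le_antisymm (iSup₂_le fun i hi => ?_) ?_⟩
    · cases i with
      | zero => simp
      | succ i => exact absurd hi (not_nontrivial_iff_subsingleton.mpr (hP i))
    · exact le_iSup₂_of_le 0 (nontrivial_gTor_zero P _) (by simp)

/-! ### A criterion for injective dimension at most one. -/

section InjectiveDimension

variable {R : Type u} [CommRing R]

/-- Since `B` is projective, `Ext^1(C, R)` is the cokernel of restriction `Hom(B, R) → Hom(A, R)`.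
-/
theorem subsingleton_extRing_one_of_extend {A B C : Type u} [AddCommGroup A] [Module R A]
    [AddCommGroup B] [Module R B] [AddCommGroup C] [Module R C] [Module.Projective R B]
    {f : A →ₗ[R] B} {g : B →ₗ[R] C} (hf : Function.Injective f) (hg : Function.Surjective g)
    (hfg : Function.Exact f g) (h : ∀ φ : A →ₗ[R] R, ∃ ψ : B →ₗ[R] R, ψ ∘ₗ f = φ) :
    Subsingleton (ExtRing (R := R) C 1) := by
  refine subsingleton_of_forall_eq 0 fun z => ?_
  have hS := shortExact_of_exact hf hg hfg
  obtain ⟨w, rfl⟩ := Abelian.Ext.contravariant_sequence_exact₃ hS _ z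
    ((subsingleton_extRing_of_projective (R := R) (A := B) 1 one_pos).elim _ _) (add_zero 1)
  obtain ⟨φ, rfl⟩ := Abelian.Ext.homEquiv₀.symm.surjective w
  obtain ⟨ψ, hψ⟩ := h φ.hom
  have hφ : φ = (ModuleCat.shortComplexOfCompEqZero f g hfg.linearMap_comp_eq_zero).f ≫
      ModuleCat.ofHom ψ := ModuleCat.hom_ext hψ.symm
  rw [Abelian.Ext.homEquiv₀_symm_apply, hφ, ← Abelian.Ext.mk₀_comp_mk₀,
    ← Abelian.Ext.comp_assoc_of_second_deg_zero, hS.extClass_comp, Abelian.Ext.zero_comp]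

/-- Baer's criterion for injective dimension at most one. -/
theorem hasInjectiveDimensionLE_one_of_ideal
    (h : ∀ J : Ideal R, Subsingleton (ExtRing (R := R) J 1)) :
    HasInjectiveDimensionLE (ModuleCat.of R R) 1 := by
  obtain ⟨I, hI, f, hf⟩ := EnoughInjectives.presentation (ModuleCat.of R R)
  have hinj : Function.Injective f.hom := (ModuleCat.mono_iff_injective f).mp hf
  have hexact := LinearMap.exact_map_mkQ_range f.hom
  have hsurj := Submodule.mkQ_surjective (LinearMap.range f.hom)
  have hIinj : Module.Injective R I := Module.injective_module_of_injective_object R I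
  -- For an injective hull-like embedding `R ⊆ I`, a map `J → I/R` lifts to `I` because `Ext^1(J, R)
  -- = 0`, and then extends to `R`.
  have hC : Module.Baer R (I ⧸ LinearMap.range f.hom) := fun J φ => by
    obtain ⟨ψ, hψ⟩ := exists_lift_of_subsingleton_extRing_one hinj hsurj hexact (h J) φ
    obtain ⟨χ, hχ⟩ := (Module.Baer.of_injective hIinj) J ψ
    refine ⟨(LinearMap.range f.hom).mkQ ∘ₗ χ, fun x hx => ?_⟩
    rw [LinearMap.comp_apply, hχ x hx, ← hψ]
    rfl
  have hCinj : Injective (ModuleCat.of R (I ⧸ LinearMap.range f.hom)) :=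
    (Module.injective_iff_injective_object R _).mp hC.injective
  exact ((shortExact_of_exact hinj hsurj hexact).hasInjectiveDimensionLT_X₃_iff 0 hI).mp
    (injective_iff_hasInjectiveDimensionLT_one.mp hCinj)

end InjectiveDimension

/-! ### Dual numbers over a discrete valuation ring. -/

section DualNumber

open DualNumber TrivSqZeroExt

variable {V : Type u} [CommRing V]

theorem dualNumber_smul_eq {K : Type*} [AddCommGroup K] [Module V[ε] K] [Module V K]
    [IsScalarTower V V[ε] K] (r : V[ε]) (k : K) :
    r • k = r.fst • k + r.snd • (ε : V[ε]) • k := by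
  conv_lhs => rw [show r = r.fst • (1 : V[ε]) + r.snd • (ε : V[ε]) by
    ext <;> simp]
  rw [add_smul, smul_assoc, smul_assoc, one_smul]

/-- A `V`-linear form `v` on a module over the dual numbers gives the linear form
`k ↦ v(ε k) + v(k) ε`. -/
def dualNumberForm {K : Type*} [AddCommGroup K] [Module V[ε] K] [Module V K]
    [IsScalarTower V V[ε] K] (v : K →ₗ[V] V) : K →ₗ[V[ε]] V[ε] where
  toFun k := inl (v ((ε : V[ε]) • k)) + inr (v k)
  map_add' a b := by
    ext <;> simp
  map_smul' r k := by
    have hε : (ε : V[ε]) • r • k = r.fst • (ε : V[ε]) • k := by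
      rw [smul_smul, mul_comm, mul_smul, dualNumber_smul_eq r, smul_smul ε ε, eps_mul_eps,
        zero_smul, smul_zero, add_zero]
    rw [hε, dualNumber_smul_eq r k]
    ext <;> simp [mul_comm]

theorem exists_retraction_ker {A B C : Type*} [CommRing A] [Algebra V A] [AddCommGroup B]
    [Module A B] [Module V B] [IsScalarTower V A B] [AddCommGroup C] [Module A C] [Module V C]
    [IsScalarTower V A C] [Module.Projective V C] (g : B →ₗ[A] C) (hg : Function.Surjective g) :
    ∃ r : B →ₗ[V] LinearMap.ker g, ∀ l : LinearMap.ker g, r l = l := by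
  obtain ⟨s, hs⟩ := Module.projective_lifting_property (g.restrictScalars V) LinearMap.id hg
  have hker (b : B) : b - s (g b) ∈ LinearMap.ker g := by
    rw [LinearMap.mem_ker, map_sub, sub_eq_zero]
    exact (LinearMap.congr_fun hs (g b)).symm
  refine ⟨{ toFun b := ⟨b - s (g b), hker b⟩, map_add' a b := ?_, map_smul' a b := ?_ },
    fun l => ?_⟩
  · ext
    simp only [map_add, Submodule.coe_add]
    abel
  · ext
    have : g (a • b) = a • g b := (g.restrictScalars V).map_smul a b
    simp [this, smul_sub]
  · ext
    simp

/-- A `V[ε]`-linear form is determined by its `ε`-coefficient, so extending it needs only the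
`V`-linear retraction `r`. -/
theorem exists_dualNumberForm_comp {L B : Type*} [AddCommGroup L] [Module V[ε] L] [Module V L]
    [IsScalarTower V V[ε] L] [AddCommGroup B] [Module V[ε] B] [Module V B]
    [IsScalarTower V V[ε] B] (f : L →ₗ[V[ε]] B) (r : B →ₗ[V] L) (hr : ∀ l, r (f l) = l)
    (φ : L →ₗ[V[ε]] V[ε]) : ∃ ψ : B →ₗ[V[ε]] V[ε], ψ ∘ₗ f = φ := by
  refine ⟨dualNumberForm (sndHom V V ∘ₗ φ.restrictScalars V ∘ₗ r), LinearMap.ext fun l => ?_⟩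
  have hε : r ((ε : V[ε]) • f l) = (ε : V[ε]) • l := by rw [← map_smul, hr]
  have h2 : φ ((ε : V[ε]) • l) = ε * φ l := map_smul φ ε l
  change inl (φ (r ((ε : V[ε]) • f l))).snd + inr (φ (r (f l))).snd = φ l
  rw [hε, h2, hr]
  ext <;> simp

theorem subsingleton_extRing_one_dualNumber (K : Type u) [AddCommGroup K] [Module V[ε] K]
    [Module V K] [IsScalarTower V V[ε] K] [Module.Projective V K] :
    Subsingleton (ExtRing (R := V[ε]) K 1) := by
  let π : (K →₀ V[ε]) →ₗ[V[ε]] K := Finsupp.linearCombination V[ε] id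
  have hπ : Function.Surjective π := fun k => ⟨Finsupp.single k 1, by simp [π]⟩
  obtain ⟨r, hr⟩ := exists_retraction_ker (V := V) π hπ
  exact subsingleton_extRing_one_of_extend (R := V[ε]) (A := LinearMap.ker π)
    (B := K →₀ V[ε]) (f := (LinearMap.ker π).subtype) (g := π) (Submodule.injective_subtype _) hπ
    (LinearMap.exact_subtype_ker_map π)
    fun φ => exists_dualNumberForm_comp (V := V) (L := LinearMap.ker π) (B := K →₀ V[ε])
      (LinearMap.ker π).subtype r hr φ

variable [IsDomain V] [IsDiscreteValuationRing V]

instance : IsLocalRing V[ε] :=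
  have : IsLocalHom (fstHom V V V).toRingHom := ⟨fun _ ha => isUnit_iff_isUnit_fst.mpr ha⟩
  (fstHom V V V).toRingHom.domain_isLocalRing

instance : Module.Finite V V[ε] := inferInstanceAs (Module.Finite V (V × V))

instance : Module.IsTorsionFree V V[ε] := inferInstanceAs (Module.IsTorsionFree V (V × V))

instance : IsNoetherianRing V[ε] := isNoetherian_of_tower V inferInstance

/-- Ideals are finitely generated and torsion-free over `V`, hence `V`-free, so their `Ext^1`
vanishes. -/
instance : IsGorensteinLocalRing V[ε] where
  finite_injectiveDimension := ⟨1, hasInjectiveDimensionLE_one_of_ideal fun J => by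
    have h1 : Module.Finite V J :=
      inferInstanceAs (Module.Finite V (J.restrictScalars V))
    have h2 : Module.IsTorsionFree V J :=
      inferInstanceAs (Module.IsTorsionFree V (J.restrictScalars V))
    have h3 : Module.Free V J := Module.free_of_finite_type_torsion_free'
    exact subsingleton_extRing_one_dualNumber J⟩

/-- The kernel of `V[ε] → V` squares to zero elementwise, so every prime contains it. -/
theorem ringKrullDim_dualNumber : ringKrullDim V[ε] = 1 := by
  rw [← IsPrincipalIdealRing.ringKrullDim_eq_one V (IsDiscreteValuationRing.not_isField V)]
  let f : V[ε] →+* V := (fstHom V V V).toRingHom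
  have hf : Function.Surjective f := fun a => ⟨inl a, rfl⟩
  rw [← ringKrullDim_eq_of_ringEquiv (R := V[ε] ⧸ RingHom.ker f) (RingHom.quotientKerEquivOfSurjective hf),
    ringKrullDim_quotient]
  have : PrimeSpectrum.zeroLocus (RingHom.ker f : Set V[ε]) = Set.univ := by
    refine Set.eq_univ_of_forall fun p z hz => ?_
    have hz2 : z * z = 0 := by
      have : z.fst = 0 := hz
      ext <;> simp [this]
    exact (p.isPrime.mem_or_mem (hz2 ▸ p.asIdeal.zero_mem : z * z ∈ p.asIdeal)).elim id id
  rw [this]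
  exact (Order.krullDim_eq_of_orderIso OrderIso.Set.univ).symm

/-- If `m = (b)`, then `π ∈ m` forces `b.fst ≠ 0`; comparing coefficients in `ε = c b` gives `c.fst
= 0` and `c.snd * b.fst = 1`, making `b` a unit. -/
theorem not_isRegularLocalRing_dualNumber : ¬ IsRegularLocalRing V[ε] := by
  intro h
  have h1 : (maximalIdeal V[ε]).spanFinrank = 1 := by
    have := h.spanFinrank_maximalIdeal
    rw [ringKrullDim_dualNumber] at this
    exact_mod_cast this
  obtain ⟨⟨b, hb⟩, -⟩ := (Submodule.spanFinrank_eq_one_iff _).mp h1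
  obtain ⟨π, hπ⟩ := IsDiscreteValuationRing.exists_irreducible V
  have hmem (z : V[ε]) (hz : ¬ IsUnit z.fst) : ∃ c, c * b = z := by
    have : z ∈ maximalIdeal V[ε] := (mem_maximalIdeal z).mpr fun hu =>
      hz (isUnit_iff_isUnit_fst.mp hu)
    rw [hb] at this
    exact Ideal.mem_span_singleton'.mp this
  obtain ⟨c, hc⟩ := hmem ε (by simp)
  obtain ⟨d, hd⟩ := hmem (inl π) hπ.not_isUnit
  have hd1 : d.fst * b.fst = π := by simpa using congrArg TrivSqZeroExt.fst hd
  have hc1 : c.fst * b.fst = 0 := by simpa using congrArg TrivSqZeroExt.fst hc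
  have hc2 := congrArg TrivSqZeroExt.snd hc
  have hb0 : b.fst ≠ 0 := fun h0 => hπ.ne_zero (by rw [← hd1, h0, mul_zero])
  have hc0 : c.fst = 0 := (mul_eq_zero.mp hc1).resolve_right hb0
  have hunit : c.snd * b.fst = 1 := by simpa [hc0] using hc2
  have hbm : b ∈ maximalIdeal V[ε] := hb ▸ Submodule.mem_span_singleton_self b
  exact (mem_maximalIdeal b).mp hbm (isUnit_iff_isUnit_fst.mpr (.of_mul_eq_one_right _ hunit))

end DualNumber

end RelHom

end

theorem mainTheorem4 :
    (∀ (R : Type u) [CommRing R] [RelHom.IsGorensteinLocalRing R],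
      ringKrullDim R = 1 → ¬ IsRegularLocalRing R →
        RelHom.GDim R (IsLocalRing.ResidueField R) = 1 ∧
        RelHom.t R (IsLocalRing.ResidueField R) (IsLocalRing.ResidueField R) = 1 ∧
        Nonempty (RelHom.ProperResolution R (IsLocalRing.ResidueField R)) ∧
        ∀ P : RelHom.ProperResolution R (IsLocalRing.ResidueField R),
          Subsingleton (RelHom.GTor P (IsLocalRing.ResidueField R) 1) ∧
          RelHom.s P (IsLocalRing.ResidueField R) = 0) ∧
    (∃ (R : Type) (_ : CommRing R) (_ : IsLocalRing R) (_ : IsNoetherianRing R)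
        (M : Type) (_ : AddCommGroup M) (_ : Module R M)
        (N : Type) (_ : AddCommGroup N) (_ : Module R N),
      Module.Finite R M ∧ Nontrivial M ∧ Module.Finite R N ∧ Nontrivial N ∧
      RelHom.GDim R M < ⊤ ∧
      Nonempty (RelHom.ProperResolution R M) ∧
      ∀ P : RelHom.ProperResolution R M, RelHom.s P N < RelHom.t R M N) := by
  refine ⟨fun R _ _ hdim hR => RelHom.residueField_of_not_isRegularLocalRing R hdim hR, ?_⟩
  obtain ⟨hG, ht, hP, hs⟩ := RelHom.residueField_of_not_isRegularLocalRing
    (DualNumber (PowerSeries ℚ)) RelHom.ringKrullDim_dualNumber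
    RelHom.not_isRegularLocalRing_dualNumber
  refine ⟨DualNumber (PowerSeries ℚ), inferInstance, inferInstance, inferInstance,
    IsLocalRing.ResidueField (DualNumber (PowerSeries ℚ)), inferInstance, inferInstance,
    IsLocalRing.ResidueField (DualNumber (PowerSeries ℚ)), inferInstance, inferInstance,
    inferInstance, inferInstance, inferInstance, inferInstance, ?_, hP, fun P => ?_⟩
  · rw [hG]
    exact ENat.one_lt_top
  · rw [(hs P).2, ht]
    exact zero_lt_one
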